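/- Let $G$ be a totally disconnected, locally compact group, and let $\operatorname{Aut}(G)$ be the group of automorphisms of $G$ that are continuous with continuous inverse. Let $\mathcal{B}(G)$ be the metric space of compact, open subgroups of $G$ with the distance $d(V,W)=\log\bigl(|V:V\cap W|\cdot|W:W\cap V|\bigr)$, on which $\operatorname{Aut}(G)$ acts by $\varphi.V=\varphi(V)$. A subgroup $\mathcal{H}\leqslant\operatorname{Aut}(G)$ is called flat if there is $O\in\mathcal{B}(G)$ such that $d(\varphi(O),O)\le d(\varphi(V),V)$ for all $\varphi\in\mathcal{H}$ and all $V\in\mathcal{B}(G)$. A set $B\subseteq\operatorname{Aut}(G)$ is called bounded if $B.V=\{\varphi(V):\varphi\in B\}$ has finite diameter in $\mathcal{B}(G)$ for some (equivalently, every) $V\in\mathcal{B}(G)$. For $\mathcal{H}\leqslant\operatorname{Aut}(G)$ put $$\mathcal{H}_{FC_d}:=\{\varphi\in\mathcal{H} : \varphi^{\mathcal{H}}\text{ is bounded}\},\qquad \varphi^{\mathcal{H}}:=\{\psi\varphi\psi^{-1}:\psi\in\mathcal{H}\}.$$ If $\mathcal{H}\leqslant\operatorname{Aut}(G)$ is flat,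 then $\mathcal{H}=\mathcal{H}_{FC_d}$; that is, every element of $\mathcal{H}$ has a bounded conjugacy class in $\mathcal{H}$. -/

import Mathlib

namespace TdlcFlat

/-- The group `Aut G` of bicontinuous automorphisms of a topological group, the product being
composition. -/
instance autGroup {G : Type*} [Group G] [TopologicalSpace G] : Group (G ≃ₜ* G) where
  mul φ ψ := ψ.trans φ
  one := ContinuousMulEquiv.refl G
  inv φ := φ.symm
  mul_assoc _ _ _ := rfl
  one_mul _ := rfl
  mul_one _ := rfl
  inv_mul_cancel φ := ContinuousMulEquiv.ext fun x => φ.symm_apply_apply x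

theorem autGroup_mul_apply {G : Type*} [Group G] [TopologicalSpace G] (φ ψ : G ≃ₜ* G) (x : G) :
    (φ * ψ) x = φ (ψ x) := rfl

/-- The compact open subgroups of a topological group. -/
@[ext]
structure CompactOpenSubgroup (G : Type*) [Group G] [TopologicalSpace G] where
  toSubgroup : Subgroup G
  isCompact : IsCompact (toSubgroup : Set G)
  isOpen : IsOpen (toSubgroup : Set G)

section

variable {G : Type*} [Group G] [TopologicalSpace G]

/-- The image `φ(V)` of a compact open subgroup under an automorphism. -/
def image (φ : G ≃ₜ* G) (V : CompactOpenSubgroup G) : CompactOpenSubgroup G where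
  toSubgroup := V.toSubgroup.map (φ : G →* G)
  isCompact := by
    rw [Subgroup.coe_map]
    exact V.isCompact.image φ.continuous
  isOpen := by
    rw [Subgroup.coe_map]
    exact φ.toHomeomorph.isOpenMap _ V.isOpen

/-- The natural action of `Aut G` on the compact open subgroups. -/
instance autAction : MulAction (G ≃ₜ* G) (CompactOpenSubgroup G) where
  smul := image
  one_smul V := CompactOpenSubgroup.ext (Subgroup.map_id V.toSubgroup)
  mul_smul φ ψ V := CompactOpenSubgroup.ext
    (Subgroup.map_map V.toSubgroup (φ : G →* G) (ψ : G →* G)).symm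

theorem mem_smul_iff (φ : G ≃ₜ* G) (V : CompactOpenSubgroup G) (x : G) :
    x ∈ (φ • V).toSubgroup ↔ ∃ y ∈ V.toSubgroup, φ y = x := Iff.rfl

/-- `d(V, W) = log (|V : V ∩ W| * |W : W ∩ V|)`; here `W.relIndex V = |V : V ∩ W|`. -/
noncomputable def distance (V W : CompactOpenSubgroup G) : ℝ :=
  Real.log ((W.toSubgroup.relIndex V.toSubgroup : ℝ) * (V.toSubgroup.relIndex W.toSubgroup : ℝ))

variable [IsTopologicalGroup G]

theorem relIndex_ne_zero (V W : CompactOpenSubgroup G) :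
    W.toSubgroup.relIndex V.toSubgroup ≠ 0 := by
  have : CompactSpace V.toSubgroup := isCompact_iff_compactSpace.mp V.isCompact
  have : Finite (V.toSubgroup ⧸ W.toSubgroup.subgroupOf V.toSubgroup) :=
    Subgroup.quotient_finite_of_isOpen _ (W.isOpen.preimage continuous_subtype_val)
  exact Subgroup.index_ne_zero_of_finite

theorem relIndex_le_mul (U V W : CompactOpenSubgroup G) :
    W.toSubgroup.relIndex U.toSubgroup ≤
      V.toSubgroup.relIndex U.toSubgroup * W.toSubgroup.relIndex V.toSubgroup := by
  have h := Subgroup.relIndex_inf_mul_relIndex W.toSubgroup V.toSubgroup U.toSubgroup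
  have h1 : W.toSubgroup.relIndex (V.toSubgroup ⊓ U.toSubgroup) ≤
      W.toSubgroup.relIndex V.toSubgroup :=
    Subgroup.relIndex_le_of_le_right inf_le_left (relIndex_ne_zero V W)
  have h2 : (W.toSubgroup ⊓ V.toSubgroup).relIndex U.toSubgroup ≠ 0 :=
    Subgroup.relIndex_inf_ne_zero (relIndex_ne_zero U W) (relIndex_ne_zero U V)
  calc W.toSubgroup.relIndex U.toSubgroup
      ≤ (W.toSubgroup ⊓ V.toSubgroup).relIndex U.toSubgroup :=
        Subgroup.relIndex_le_of_le_left inf_le_left h2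
    _ = W.toSubgroup.relIndex (V.toSubgroup ⊓ U.toSubgroup) *
          V.toSubgroup.relIndex U.toSubgroup := h.symm
    _ ≤ W.toSubgroup.relIndex V.toSubgroup * V.toSubgroup.relIndex U.toSubgroup :=
        Nat.mul_le_mul_right _ h1
    _ = _ := mul_comm _ _

/-- The metric space `𝓑(G)` of compact open subgroups of `G`. -/
noncomputable instance metricSpace : MetricSpace (CompactOpenSubgroup G) where
  dist := distance
  dist_self V := by simp [distance, Subgroup.relIndex_self]
  dist_comm V W := by simp only [distance]; rw [mul_comm]
  dist_triangle U V W := by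
    have pos : ∀ A B : CompactOpenSubgroup G,
        (0 : ℝ) < (A.toSubgroup.relIndex B.toSubgroup : ℝ) := fun A B =>
      Nat.cast_pos.mpr (Nat.pos_of_ne_zero (relIndex_ne_zero B A))
    have a : (W.toSubgroup.relIndex U.toSubgroup : ℝ) ≤
        V.toSubgroup.relIndex U.toSubgroup * W.toSubgroup.relIndex V.toSubgroup := by
      exact_mod_cast relIndex_le_mul U V W
    have b : (U.toSubgroup.relIndex W.toSubgroup : ℝ) ≤
        V.toSubgroup.relIndex W.toSubgroup * U.toSubgroup.relIndex V.toSubgroup := by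
      exact_mod_cast relIndex_le_mul W V U
    change distance U W ≤ distance U V + distance V W
    unfold distance
    rw [← Real.log_mul (mul_pos (pos _ _) (pos _ _)).ne' (mul_pos (pos _ _) (pos _ _)).ne']
    refine Real.log_le_log (mul_pos (pos _ _) (pos _ _)) ?_
    refine (mul_le_mul a b (pos _ _).le (mul_pos (pos _ _) (pos _ _)).le).trans (le_of_eq ?_)
    ring
  eq_of_dist_eq_zero {V W} h := by
    change distance V W = 0 at h
    unfold distance at h
    have hm : W.toSubgroup.relIndex V.toSubgroup * V.toSubgroup.relIndex W.toSubgroup = 1 := by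
      have h' : Real.log
          ((W.toSubgroup.relIndex V.toSubgroup * V.toSubgroup.relIndex W.toSubgroup : ℕ) : ℝ) = 0 := by
        push_cast; exact h
      have hne := mul_ne_zero (relIndex_ne_zero V W) (relIndex_ne_zero W V)
      rcases Real.log_eq_zero.mp h' with h0 | h0 | h0
      · exact absurd (Nat.cast_eq_zero.mp h0) hne
      · exact_mod_cast h0
      · have := Nat.cast_nonneg (α := ℝ)
          (W.toSubgroup.relIndex V.toSubgroup * V.toSubgroup.relIndex W.toSubgroup)
        linarith
    have h1 := Nat.eq_one_of_mul_eq_one_right hm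
    have h2 := Nat.eq_one_of_mul_eq_one_left hm
    exact CompactOpenSubgroup.ext
      (le_antisymm (Subgroup.relIndex_eq_one.mp h1) (Subgroup.relIndex_eq_one.mp h2))

theorem dist_def (V W : CompactOpenSubgroup G) :
    dist V W = Real.log
      ((W.toSubgroup.relIndex V.toSubgroup : ℝ) * (V.toSubgroup.relIndex W.toSubgroup : ℝ)) := rfl

/-- `O` is minimizing for `H`: it minimizes the displacement function `V ↦ d(φ(V), V)` of every
`φ ∈ H`. -/
def IsMinimizing (H : Subgroup (G ≃ₜ* G)) (O : CompactOpenSubgroup G) : Prop :=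
  ∀ φ ∈ H, ∀ V : CompactOpenSubgroup G, dist (φ • O) O ≤ dist (φ • V) V

/-- A group of automorphisms is flat if some compact open subgroup is minimizing for it. -/
def IsFlat (H : Subgroup (G ≃ₜ* G)) : Prop :=
  ∃ O : CompactOpenSubgroup G, IsMinimizing H O

/-- A set `B` of automorphisms is bounded if `B.V` has bounded diameter in `𝓑(G)` for some `V`. -/
def IsBoundedSet (B : Set (G ≃ₜ* G)) : Prop :=
  ∃ V : CompactOpenSubgroup G, Bornology.IsBounded ((fun φ : G ≃ₜ* G => φ • V) '' B)

/-- The conjugacy class `φ^H`. -/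
def conjClass (H : Subgroup (G ≃ₜ* G)) (φ : G ≃ₜ* G) : Set (G ≃ₜ* G) :=
  {χ | ∃ ψ ∈ H, χ = ψ * φ * ψ⁻¹}

/-- `H_{FC_d}`: the elements of `H` whose `H`-conjugacy class is bounded. -/
def FCd (H : Subgroup (G ≃ₜ* G)) : Set (G ≃ₜ* G) :=
  {φ | φ ∈ H ∧ IsBoundedSet (conjClass H φ)}

/-- `Aut G` acts on `𝓑(G)` by isometries. -/
theorem dist_smul_smul (φ : G ≃ₜ* G) (V W : CompactOpenSubgroup G) :
    dist (φ • V) (φ • W) = dist V W := by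
  have h : ∀ A B : CompactOpenSubgroup G,
      (φ • A).toSubgroup.relIndex (φ • B).toSubgroup = A.toSubgroup.relIndex B.toSubgroup :=
    fun A B => Subgroup.relIndex_map_map_of_injective A.toSubgroup B.toSubgroup
      (f := (φ : G →* G)) φ.injective
  rw [dist_def, dist_def, h, h]

/-- Boundedness for one compact open subgroup gives it for all of them. -/
theorem IsBoundedSet.isBounded_image {B : Set (G ≃ₜ* G)} (hB : IsBoundedSet B)
    (W : CompactOpenSubgroup G) :
    Bornology.IsBounded ((fun φ : G ≃ₜ* G => φ • W) '' B) := by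
  obtain ⟨V, hV⟩ := hB
  obtain ⟨C, hC⟩ := Metric.isBounded_iff.mp hV
  refine Metric.isBounded_iff.mpr ⟨dist W V + C + dist V W, ?_⟩
  rintro _ ⟨φ, hφ, rfl⟩ _ ⟨ψ, hψ, rfl⟩
  have h1 := hC ⟨φ, hφ, rfl⟩ ⟨ψ, hψ, rfl⟩
  have h2 := dist_triangle4 (φ • W) (φ • V) (ψ • V) (ψ • W)
  rw [dist_smul_smul, dist_smul_smul] at h2
  simp only at h1 ⊢
  linarith

end

end TdlcFlat

namespace TdlcFlat

/-! Let `O` minimize the displacement of every element of `H`. Since `Aut G` acts by isometries, `ψ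
* φ * ψ⁻¹` displaces `ψ • O` exactly as far as `φ` displaces `O`; since the conjugate lies in `H`,
it displaces `O` no farther than it displaces `ψ • O`. Hence the orbit of `O` under the conjugacy
class of `φ` stays in a ball about `O` whose radius depends on `φ` alone. -/

/-- If `O` is minimizing for `H`, then the displacement of `O` by a conjugate `ψ * φ * ψ⁻¹` is at
most the displacement of `O` by `φ`: compare `O` with `ψ • O`. -/
theorem IsMinimizing.dist_conj_smul_le {G : Type*} [Group G] [TopologicalSpace G]
    [IsTopologicalGroup G] {H : Subgroup (G ≃ₜ* G)} {O : CompactOpenSubgroup G}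
    (hO : IsMinimizing H O) {φ ψ : G ≃ₜ* G} (hφ : φ ∈ H) (hψ : ψ ∈ H) :
    dist ((ψ * φ * ψ⁻¹) • O) O ≤ dist (φ • O) O := by
  have h := hO (ψ * φ * ψ⁻¹) (H.mul_mem (H.mul_mem hψ hφ) (H.inv_mem hψ)) (ψ • O)
  -- On the right-hand side the conjugate sends `ψ • O` to `ψ • φ • O`, so the isometry `ψ` cancels
  -- from the distance. The arguments of `mul_smul` are explicit so that the conjugate acting on `O`
  -- on the left is not unfolded.
  rwa [← mul_smul, inv_mul_cancel_right, mul_smul ψ φ O, dist_smul_smul] at h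

end TdlcFlat

theorem mainTheorem8 {G : Type*} [Group G] [TopologicalSpace G] [IsTopologicalGroup G]
    [LocallyCompactSpace G] [TotallyDisconnectedSpace G]
    (H : Subgroup (G ≃ₜ* G)) (hH : TdlcFlat.IsFlat H) :
    (H : Set (G ≃ₜ* G)) = TdlcFlat.FCd H := by
  obtain ⟨O, hO⟩ := hH
  -- Boundedness may be tested on any one compact open subgroup; the minimizing `O` is the one where
  -- the displacement bound is available.
  refine Set.Subset.antisymm (fun φ hφ => ⟨hφ, O, ?_⟩) fun φ hφ => hφ.1
  -- The radius is the displacement of `O` by `φ` itself, uniform over the conjugating elements `ψ`.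
  refine Metric.isBounded_closedBall.subset (t := Metric.closedBall O (dist (φ • O) O)) ?_
  rintro _ ⟨_, ⟨ψ, hψ, rfl⟩, rfl⟩
  exact hO.dist_conj_smul_le hφ hψ
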